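/- For every integer $k\ge 2$, the problems $\mathsf{HPC}(k)$ and $\mathsf{WF}$ are strongly Weihrauch equivalent, $\mathsf{HPC}(k)\equiv_{\mathrm{sW}}\mathsf{WF}$. Here $\mathsf{WF}$ takes as input a tree $T\subseteq\mathbb N^{<\mathbb N}$ (a set of finite sequences closed under initial segments, given by its characteristic function) and outputs $1$ if $T$ is well-founded, i.e. has no infinite path, and $0$ otherwise. The problem $\mathsf{HPC}(k)$ takes as input a hypergraph $H=(V,E)$ with $V\subseteq\mathbb N$ and $E$ an at most countable set of subsets of $V$ of arbitrary cardinality (given by the characteristic function of $V$, that of an index set $I\subseteq\mathbb N$, and those of edges $e_i$, $i\in I$, with $E=\{e_i : i\in I\}$), and outputs $1$ if $H$ has a proper $k$-coloring and $0$ otherwise; a $k$-coloring $f:V\to\{0,\dots,k-1\}$ is proper if every edge with at least two vertices contains two vertices of different colors. An output $n\in\mathbb N$ is named by any $q\in\mathbb N^{\mathbb N}$ with $q(0)=n$. A realizer of a problem $f$ is a partial function $G:\subseteq\mathbb N^{\mathbb N}\to\mathbb N^{\mathbb N}$ that maps every name of an input of $f$ to a name of a solution. For problems $f,g$, $f\le_{\mathrm{sW}}g$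 means that there are computable partial functions $\Phi,\Psi:\subseteq\mathbb N^{\mathbb N}\to\mathbb N^{\mathbb N}$ such that $\Phi\circ G\circ\Psi$ is a realizer of $f$ for every realizer $G$ of $g$; and $f\equiv_{\mathrm{sW}}g$ means $f\le_{\mathrm{sW}}g$ and $g\le_{\mathrm{sW}}f$. -/

import Mathlib

/-- Baire space `ℕ^ℕ`. -/
abbrev Baire : Type := ℕ → ℕ

/-- Partial recursive functionals `Φ : Baire × ℕ ⇀ ℕ`, in an oracle `p` and a number, uniformly in
the oracle: the least class that contains zero, successor, the two projections and the evaluation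
`(p, n) ↦ p n`, and is closed under pairing, composition, primitive recursion and minimization.
This is `Nat.RecursiveIn` with one derivation serving all oracles simultaneously. -/
inductive RecFunctional : (Baire → ℕ →. ℕ) → Prop
  | zero : RecFunctional fun _ _ => Part.some 0
  | succ : RecFunctional fun _ n => Part.some (n + 1)
  | left : RecFunctional fun _ n => Part.some n.unpair.1
  | right : RecFunctional fun _ n => Part.some n.unpair.2
  | oracle : RecFunctional fun p n => Part.some (p n)
  | pair {Φ Ψ : Baire → ℕ →. ℕ} : RecFunctional Φ → RecFunctional Ψ →
      RecFunctional fun p n => Nat.pair <$> Φ p n <*> Ψ p n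
  | comp {Φ Ψ : Baire → ℕ →. ℕ} : RecFunctional Φ → RecFunctional Ψ →
      RecFunctional fun p n => Ψ p n >>= Φ p
  | prec {Φ Ψ : Baire → ℕ →. ℕ} : RecFunctional Φ → RecFunctional Ψ →
      RecFunctional fun p => Nat.unpaired fun a n =>
        n.rec (Φ p a) fun y IH => IH >>= fun i => Ψ p (Nat.pair a (Nat.pair y i))
  | rfind {Φ : Baire → ℕ →. ℕ} : RecFunctional Φ →
      RecFunctional fun p a => Nat.rfind fun n => (fun m => decide (m = 0)) <$> Φ p (Nat.pair a n)

/-- A partial function on Baire space is computable if one oracle algorithm computes, for every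
`p` in its domain, the value at `p` entry by entry. -/
def ComputableOnBaire (F : Baire →. Baire) : Prop :=
  ∃ Φ : Baire → ℕ →. ℕ, RecFunctional Φ ∧ ∀ p q, q ∈ F p → ∀ n, q n ∈ Φ p n

/-- A represented space: `Names` is the graph of a partial surjection from Baire space onto `X`. -/
class RepresentedSpace (X : Type*) where
  /-- `Names p x`: the point `p` of Baire space is a name of `x`. -/
  Names : Baire → X → Prop
  unique : ∀ {p : Baire} {x y : X}, Names p x → Names p y → x = y
  surjective : ∀ x : X, ∃ p : Baire, Names p x

/-- A problem: a partial multivalued function; `f x` is the set of solutions of `x`, and the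
domain is the set of `x` that have a solution. -/
abbrev Problem (X Y : Type*) : Type _ := X → Set Y

/-- `G` realizes `f`: it maps every name of every `x` in the domain of `f` to a name of a
solution. -/
def Realizes {X Y : Type*} [RepresentedSpace X] [RepresentedSpace Y]
    (G : Baire →. Baire) (f : Problem X Y) : Prop :=
  ∀ (p : Baire) (x : X), RepresentedSpace.Names p x → (f x).Nonempty →
    ∃ q ∈ G p, ∃ y ∈ f x, RepresentedSpace.Names q y

/-- Strong Weihrauch reducibility `f ≤_sW g`. -/
def StrongWeihrauchReducible {X Y Z W : Type*} [RepresentedSpace X] [RepresentedSpace Y]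
    [RepresentedSpace Z] [RepresentedSpace W] (f : Problem X Y) (g : Problem Z W) : Prop :=
  ∃ H K : Baire →. Baire, ComputableOnBaire H ∧ ComputableOnBaire K ∧
    ∀ G : Baire →. Baire, Realizes G g → Realizes (H.comp (G.comp K)) f

/-- Strong Weihrauch equivalence `f ≡_sW g`. -/
def StrongWeihrauchEquiv {X Y Z W : Type*} [RepresentedSpace X] [RepresentedSpace Y]
    [RepresentedSpace Z] [RepresentedSpace W] (f : Problem X Y) (g : Problem Z W) : Prop :=
  StrongWeihrauchReducible f g ∧ StrongWeihrauchReducible g f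

/-- The standard representation `p ↦ p 0` of `ℕ`. -/
instance : RepresentedSpace ℕ where
  Names p n := p 0 = n
  unique h₁ h₂ := h₁.symm.trans h₂
  surjective n := ⟨fun _ => n, rfl⟩

/-- The characteristic function of a set of natural numbers. -/
noncomputable def charFun (S : Set ℕ) : Baire := S.indicator 1

theorem charFun_injective : Function.Injective charFun := by
  intro S T h
  ext n
  have := congrFun h n
  by_cases h₁ : n ∈ S <;> by_cases h₂ : n ∈ T <;> simp_all [charFun]

/-- A tree on `ℕ` is named by the characteristic function of the set of codes of its nodes. -/
noncomputable instance : RepresentedSpace (Descriptive.tree ℕ) where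
  Names p T := p = charFun (Encodable.encode '' (T : Set (List ℕ)))
  unique {p x y} h₁ h₂ := by
    have := charFun_injective (h₁.symm.trans h₂)
    exact Subtype.ext (Set.image_injective.2 Encodable.encode_injective this)
  surjective T := ⟨_, rfl⟩

/-- A tree is well-founded if it has no infinite path. -/
def IsWellFoundedTree (T : Descriptive.tree ℕ) : Prop :=
  ¬ ∃ f : ℕ → ℕ, ∀ n, (List.range n).map f ∈ T

open Classical in
/-- The problem `WF`: output `1` if the given tree is well-founded, and `0` otherwise. -/
noncomputable def WF : Problem (Descriptive.tree ℕ) ℕ :=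
  fun T => {if IsWellFoundedTree T then 1 else 0}

/-- Hypergraphs with a vertex set `V ⊆ ℕ` (finite or infinite) and a finite or countably infinite
set of edges, each an arbitrary subset of `V`. -/
def CountableHypergraph : Type := {H : Hypergraph ℕ // H.edgeSet.Countable}

/-- `p` is a name of `(V, E)` if it codes the characteristic function of `V`, that of a set `I` of
indices, and that of `e i` for each `i ∈ I`, where `i ↦ e i` maps `I` onto `E`. -/
def NamesHypergraph (p : Baire) (H : CountableHypergraph) : Prop :=
  ∃ (I : Set ℕ) (e : ℕ → Set ℕ),
    (fun v => p (Nat.pair 0 v)) = charFun H.1.vertexSet ∧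
    (fun i => p (Nat.pair 1 i)) = charFun I ∧
    (∀ i ∈ I, (fun v => p (Nat.pair (i + 2) v)) = charFun (e i)) ∧
    H.1.edgeSet = e '' I

noncomputable instance : RepresentedSpace CountableHypergraph where
  Names := NamesHypergraph
  unique {p x y} h₁ h₂ := by
    obtain ⟨I, e, hV, hI, he, hE⟩ := h₁
    obtain ⟨J, d, hW, hJ, hd, hD⟩ := h₂
    obtain rfl := charFun_injective (hI.symm.trans hJ)
    refine Subtype.ext (Hypergraph.ext (charFun_injective (hV.symm.trans hW)) ?_)
    rw [hE, hD]
    exact Set.image_congr fun i hi => charFun_injective ((he i hi).symm.trans (hd i hi))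
  surjective H := by
    obtain ⟨I, e, h⟩ : ∃ (I : Set ℕ) (e : ℕ → Set ℕ), H.1.edgeSet = e '' I := by
      rcases H.1.edgeSet.eq_empty_or_nonempty with h | h
      · exact ⟨∅, fun _ => ∅, by simp [h]⟩
      · obtain ⟨e, he⟩ := H.2.exists_eq_range h
        exact ⟨Set.univ, e, by simp [he]⟩
    refine ⟨fun n => match n.unpair.1 with
      | 0 => charFun H.1.vertexSet n.unpair.2
      | 1 => charFun I n.unpair.2
      | i + 2 => charFun (e i) n.unpair.2, I, e, ?_, ?_, ?_, h⟩
    · simp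
    · simp
    · simp

/-- A `k`-coloring of the vertices is proper if every edge with at least two vertices contains
vertices of different colors. -/
def IsProperColoring (H : CountableHypergraph) {k : ℕ} (f : H.1.vertexSet → Fin k) : Prop :=
  ∀ e ∈ H.1.edgeSet, e.Nontrivial → ∃ u v : H.1.vertexSet, u.1 ∈ e ∧ v.1 ∈ e ∧ f u ≠ f v

open Classical in
/-- The problem `HPC(k)`: output `1` if the given hypergraph has a proper `k`-coloring, and `0`
otherwise. -/
noncomputable def HPC (k : ℕ) : Problem CountableHypergraph ℕ :=
  fun H => {if ∃ f : H.1.vertexSet → Fin k, IsProperColoring H f then 1 else 0}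

/-!
Call a constraint on functions `f : ℕ → ℕ` local if it is the `n`-th of a sequence of decidable
constraints and reads only `f 0, …, f n`. The problem whether some `f` satisfies all constraints of
a local sequence reduces to `WF` with the answers exchanged: the finite sequences that violate no
constraint so far form a tree whose infinite paths are the solutions `f`. Colorability has this form
once a coloring is accompanied, for every edge, by a guess of two vertices of different colors in
it; the guesses remove the search for such vertices.

Conversely, a tree has an infinite path if and only if there is a set of true nodes that contains
the root and with each node one of its children in the tree. This is a hypergraph coloring problem:
joining `k - 2` vertices to all others leaves two colors, the truth values, for the remaining ones,
and the demand that a true node has a true child is the edge that consists of a false vertex, the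
negation of the node and all its children.
-/

/-! ### Total functionals computable in an oracle -/

section Oracle

open Encodable

variable {α β γ σ : Type*} [Primcodable α] [Primcodable β] [Primcodable γ] [Primcodable σ]

theorem RecFunctional.prec_total {F G : Baire → ℕ → ℕ}
    (hF : RecFunctional fun p n => Part.some (F p n))
    (hG : RecFunctional fun p n => Part.some (G p n)) :
    RecFunctional fun p n => Part.some (Nat.unpaired (fun a n =>
      n.rec (F p a) fun y i => G p (Nat.pair a (Nat.pair y i))) n) := by
  refine (congrArg RecFunctional (funext₂ fun p n => ?_)).mp (RecFunctional.prec hF hG)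
  simp only [Nat.unpaired]
  induction n.unpair.2 with
  | zero => rfl
  | succ y ih => exact (congrArg (Part.bind · _) ih).trans (Part.bind_some _ _)

theorem RecFunctional.of_primrec {f : ℕ → ℕ} (hf : Nat.Primrec f) :
    RecFunctional fun _ n => Part.some (f n) := by
  induction hf with
  | zero => exact .zero
  | succ => exact .succ
  | left => exact .left
  | right => exact .right
  | pair _ _ ihf ihg =>
    convert RecFunctional.pair ihf ihg using 3
    simp [Seq.seq]
  | comp _ _ ihf ihg =>
    convert RecFunctional.comp ihf ihg using 3
    simp
  | prec _ _ ihf ihg => exact .prec_total ihf ihg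

/-- A total functional `f`, uniformly computable in its oracle, between types of coded objects. -/
def OracleComputable (f : Baire → α → σ) : Prop :=
  ∃ F : Baire → ℕ → ℕ, RecFunctional (fun p n => Part.some (F p n)) ∧
    ∀ p a, F p (encode a) = encode (f p a)

namespace OracleComputable

theorem of_primrec {f : α → σ} (hf : Primrec f) : OracleComputable fun _ => f :=
  ⟨fun _ n => (encode ((decode n : Option α).map f)).pred,
    .of_primrec (Nat.Primrec.pred.comp hf), fun _ _ => by simp⟩

theorem oracle : OracleComputable fun p (n : ℕ) => p n :=
  ⟨fun p n => p n, .oracle, fun _ _ => rfl⟩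

theorem comp {f : Baire → β → σ} {g : Baire → α → β} (hf : OracleComputable f)
    (hg : OracleComputable g) : OracleComputable fun p a => f p (g p a) := by
  obtain ⟨F, hF, hFf⟩ := hf
  obtain ⟨G, hG, hGg⟩ := hg
  refine ⟨fun p n => F p (G p n), ?_, fun p a => by simp only [hGg, hFf]⟩
  convert RecFunctional.comp hF hG using 3
  simp

theorem pair {f : Baire → α → β} {g : Baire → α → γ} (hf : OracleComputable f)
    (hg : OracleComputable g) : OracleComputable fun p a => (f p a, g p a) := by
  obtain ⟨F, hF, hFf⟩ := hf
  obtain ⟨G, hG, hGg⟩ := hg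
  refine ⟨fun p n => Nat.pair (F p n) (G p n), ?_, fun p a => by simp [hFf, hGg]⟩
  convert RecFunctional.pair hF hG using 3
  simp [Seq.seq]

theorem nat_rec {f : Baire → α → σ} {g : Baire → α × ℕ × σ → σ} (hf : OracleComputable f)
    (hg : OracleComputable g) :
    OracleComputable fun p (x : α × ℕ) =>
      (x.2.rec (f p x.1) fun y ih => g p (x.1, y, ih) : σ) := by
  obtain ⟨F, hF, hFf⟩ := hf
  obtain ⟨G, hG, hGg⟩ := hg
  refine ⟨fun p => Nat.unpaired fun a n =>
    n.rec (F p a) fun y i => G p (Nat.pair a (Nat.pair y i)), .prec_total hF hG, fun p x => ?_⟩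
  obtain ⟨a, n⟩ := x
  simp only [Nat.unpaired, encode_prod_val, Nat.unpair_pair, encode_nat]
  induction n with
  | zero => exact hFf p a
  | succ n ih =>
    simp only [ih]
    exact hGg p (a, n, _)

theorem computableOnBaire {F : Baire → Baire} (hF : OracleComputable F) :
    ComputableOnBaire fun p => Part.some (F p) := by
  obtain ⟨Φ, hΦ, hΦF⟩ := hF
  refine ⟨_, hΦ, fun p q hq n => ?_⟩
  obtain rfl := Part.mem_some_iff.1 hq
  exact Part.mem_some_iff.2 (hΦF p n).symm

end OracleComputable

open Classical in
/-- A predicate that is decidable uniformly in the oracle. -/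
def OracleDecidable (P : Baire → α → Prop) : Prop :=
  OracleComputable fun p a => decide (P p a)

namespace OracleDecidable

theorem of_primrecPred {P : α → Prop} (hP : PrimrecPred P) : OracleDecidable fun _ => P := by
  classical
  exact .of_primrec hP.decide

theorem comp {P : Baire → β → Prop} {g : Baire → α → β} (hP : OracleDecidable P)
    (hg : OracleComputable g) : OracleDecidable fun p a => P p (g p a) :=
  OracleComputable.comp hP hg

theorem comp_primrec {P : Baire → β → Prop} {g : α → β} (hP : OracleDecidable P)
    (hg : Primrec g) : OracleDecidable fun p a => P p (g a) :=
  hP.comp (.of_primrec hg)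

theorem not {P : Baire → α → Prop} (hP : OracleDecidable P) :
    OracleDecidable fun p a => ¬ P p a := by
  unfold OracleDecidable
  convert (OracleComputable.of_primrec Primrec.not).comp hP using 3
  simp

theorem and {P Q : Baire → α → Prop} (hP : OracleDecidable P) (hQ : OracleDecidable Q) :
    OracleDecidable fun p a => P p a ∧ Q p a := by
  unfold OracleDecidable
  convert (OracleComputable.of_primrec Primrec.and).comp (hP.pair hQ) using 3 with p a
  by_cases h : P p a <;> by_cases h' : Q p a <;> simp [h, h']

theorem or {P Q : Baire → α → Prop} (hP : OracleDecidable P) (hQ : OracleDecidable Q) :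
    OracleDecidable fun p a => P p a ∨ Q p a := by
  simpa only [not_and_or, not_not] using (hP.not.and hQ.not).not

theorem imp {P Q : Baire → α → Prop} (hP : OracleDecidable P) (hQ : OracleDecidable Q) :
    OracleDecidable fun p a => P p a → Q p a := by
  simpa only [imp_iff_not_or] using hP.not.or hQ

theorem oracle_ne_zero : OracleDecidable fun p (n : ℕ) => p n ≠ 0 :=
  (of_primrecPred (Primrec.eq.comp .id (.const 0)).not).comp .oracle

theorem forall_lt {P : Baire → α × ℕ → Prop} (hP : OracleDecidable P) :
    OracleDecidable fun p (x : α × ℕ) => ∀ t < x.2, P p (x.1, t) := by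
  classical
  have h := OracleComputable.nat_rec (α := α) (σ := Bool)
    (f := fun _ _ => true) (g := fun p x => x.2.2 && decide (P p (x.1, x.2.1)))
    (.of_primrec (.const true))
    ((OracleComputable.of_primrec Primrec.and).comp
      (.pair (.of_primrec (Primrec.snd.comp .snd))
        (hP.comp_primrec (Primrec.fst.pair (Primrec.fst.comp .snd)))))
  unfold OracleDecidable
  convert h using 3 with p x
  obtain ⟨a, n⟩ := x
  simp only
  induction n with
  | zero => simp
  | succ n ih =>
    simp only [← ih, Nat.forall_lt_succ_right, Bool.decide_and]
    congr

theorem exists_and_eq_of_leftInverse {P : Baire → γ × α → Prop} (hP : OracleDecidable P)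
    {g : γ × α → β} (hg : Primrec g) {r : β → α} (hr : Primrec r) (hrg : ∀ x, r (g x) = x.2) :
    OracleDecidable fun p (x : γ × β) => ∃ a, P p (x.1, a) ∧ g (x.1, a) = x.2 := by
  have hpre : Primrec fun x : γ × β => (x.1, r x.2) := Primrec.fst.pair (hr.comp .snd)
  convert (hP.comp_primrec hpre).and
    (of_primrecPred (Primrec.eq.comp (hg.comp hpre) .snd)) using 3 with p x
  refine ⟨fun ⟨a, ha, hgx⟩ => ?_, fun h => ⟨_, h⟩⟩
  obtain rfl : a = r x.2 := by rw [← hgx, hrg]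
  exact ⟨ha, hgx⟩

theorem sumElim [Inhabited α] [Inhabited β] {E : Baire → α → Set γ} {F : Baire → β → Set γ}
    (hE : OracleDecidable fun p (x : α × γ) => x.2 ∈ E p x.1)
    (hF : OracleDecidable fun p (x : β × γ) => x.2 ∈ F p x.1) :
    OracleDecidable fun p (x : (α ⊕ β) × γ) => x.2 ∈ Sum.elim (E p) (F p) x.1 := by
  let left : α ⊕ β → α := Sum.elim id default
  let right : α ⊕ β → β := Sum.elim default id
  have hleft : Primrec fun x : (α ⊕ β) × γ => left x.1 :=
    (Primrec.sumCasesOn .fst .right (Primrec.const default).to₂).of_eq fun x => by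
      rcases x with ⟨_ | _, _⟩ <;> rfl
  have hright : Primrec fun x : (α ⊕ β) × γ => right x.1 :=
    (Primrec.sumCasesOn .fst (Primrec.const default).to₂ .right).of_eq fun x => by
      rcases x with ⟨_ | _, _⟩ <;> rfl
  convert ((of_primrecPred (Primrec.eq.comp .fst (Primrec.sumInl.comp hleft))).and
      (hE.comp_primrec (hleft.pair .snd))).or
    ((of_primrecPred (Primrec.eq.comp .fst (Primrec.sumInr.comp hright))).and
      (hF.comp_primrec (hright.pair .snd))) using 3 with p x
  rcases x with ⟨_ | _, _⟩ <;> simp [left, right]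

end OracleDecidable

end Oracle

theorem charFun_ne_zero_iff {S : Set ℕ} {n : ℕ} : charFun S n ≠ 0 ↔ n ∈ S := by
  by_cases h : n ∈ S <;> simp [charFun, h]

theorem OracleDecidable.computableOnBaire_charFun {P : Baire → ℕ → Prop}
    (hP : OracleDecidable P) : ComputableOnBaire fun p => Part.some (charFun {n | P p n}) := by
  classical
  refine OracleComputable.computableOnBaire ?_
  convert (OracleComputable.of_primrec Primrec.encode).comp hP using 3 with p n
  by_cases h : P p n <;> simp [charFun, h]

/-! ### Decision problems -/

open Classical in
/-- The problem to decide `A`; both `WF` and `HPC k` have this form. -/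
noncomputable def decisionProblem {X : Type*} (A : X → Prop) : Problem X ℕ :=
  fun x => {if A x then 1 else 0}

theorem strongWeihrauchReducible_of_iff_not {X Z : Type*} [RepresentedSpace X]
    [RepresentedSpace Z] {A : X → Prop} {B : Z → Prop} {F : Baire → Baire}
    (hF : ComputableOnBaire fun p => Part.some (F p))
    (h : ∀ p x, RepresentedSpace.Names p x →
      ∃ z : Z, RepresentedSpace.Names (F p) z ∧ (A x ↔ ¬ B z)) :
    StrongWeihrauchReducible (decisionProblem A) (decisionProblem B) := by
  have hneg : OracleComputable fun q (_ : ℕ) => 1 - q 0 :=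
    (OracleComputable.of_primrec (Primrec.nat_sub.comp (.const 1) .id)).comp
      (OracleComputable.oracle.comp (.of_primrec (.const 0)))
  refine ⟨_, _, hneg.computableOnBaire, hF, fun G hG p x hp _ => ?_⟩
  obtain ⟨z, hz, hAB⟩ := h p x hp
  obtain ⟨q, hq, y, rfl, hqy⟩ := hG (F p) z hz (Set.singleton_nonempty _)
  refine ⟨fun _ => 1 - q 0, ?_, _, rfl, ?_⟩
  · exact Part.mem_bind (Part.mem_bind (Part.mem_some _) hq) (Part.mem_some _)
  · change q 0 = _ at hqy
    change 1 - q 0 = _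
    by_cases hB : B z <;> simp_all

/-! ### Reducing to well-foundedness -/

/-- A family of constraints on functions `f : ℕ → ℕ` is local if the `n`-th constraint depends only
on `f 0, …, f n`. -/
def IsLocal (C : (ℕ → ℕ) → ℕ → Prop) : Prop :=
  ∀ ⦃f g : ℕ → ℕ⦄ ⦃n⦄, (∀ i ≤ n, f i = g i) → C f n → C g n

/-- The tree of finite sequences that violate none of the constraints they determine. -/
def constraintTree (C : (ℕ → ℕ) → ℕ → Prop) (hC : IsLocal C) : Descriptive.tree ℕ :=
  ⟨{s | ∀ n < s.length, C (s.getD · 0) n}, fun s a h n hn =>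
    hC (fun i hi => List.getD_append _ _ _ _ (hi.trans_lt hn))
      (h n (by rw [List.length_append]; exact Nat.lt_add_right _ hn))⟩

theorem mem_constraintTree {C : (ℕ → ℕ) → ℕ → Prop} {hC : IsLocal C} {s : List ℕ} :
    s ∈ constraintTree C hC ↔ ∀ n < s.length, C (s.getD · 0) n :=
  Iff.rfl

theorem forall_map_range_mem_constraintTree_iff {C : (ℕ → ℕ) → ℕ → Prop} {hC : IsLocal C}
    {f : ℕ → ℕ} : (∀ n, (List.range n).map f ∈ constraintTree C hC) ↔ ∀ n, C f n := by
  have agree {n i : ℕ} (hi : i < n) : ((List.range n).map f).getD i 0 = f i := by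
    simp [List.getD, hi]
  simp only [mem_constraintTree, List.length_map, List.length_range]
  exact ⟨fun h n => hC (fun i hi => agree (Nat.lt_succ_of_le hi)) (h (n + 1) n n.lt_succ_self),
    fun h n m hm => hC (fun i hi => (agree (hi.trans_lt hm)).symm) (h m)⟩

theorem encode_image_eq {α : Type*} [Denumerable α] (S : Set α) :
    Encodable.encode '' S = {n | Denumerable.ofNat α n ∈ S} :=
  (Denumerable.eqv α).image_eq_preimage_symm S

theorem decisionProblem_strongWeihrauchReducible_wf {X : Type*} [RepresentedSpace X]
    {A : X → Prop} {C : Baire → (ℕ → ℕ) → ℕ → Prop} (hloc : ∀ p, IsLocal (C p))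
    (hC : OracleDecidable fun p (x : List ℕ × ℕ) => C p (x.1.getD · 0) x.2)
    (h : ∀ p x, RepresentedSpace.Names p x → (A x ↔ ∃ f, ∀ n, C p f n)) :
    StrongWeihrauchReducible (decisionProblem A) WF := by
  have hcomp : ComputableOnBaire fun p => Part.some
      (charFun (Encodable.encode '' (constraintTree (C p) (hloc p) : Set (List ℕ)))) := by
    simp only [encode_image_eq]
    have hs := Primrec.ofNat (List ℕ)
    exact (hC.forall_lt.comp_primrec
      (hs.pair (Primrec.list_length.comp hs))).computableOnBaire_charFun
  refine strongWeihrauchReducible_of_iff_not hcomp fun p x hp => ⟨_, rfl, ?_⟩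
  simp only [IsWellFoundedTree, not_not, forall_map_range_mem_constraintTree_iff, h p x hp]

/-! ### Proper colorings of indexed families of edges -/

section ProperlyColors

variable {ι κ V α : Type*}

/-- The function `c` on vertices is a proper coloring of the family `e` of edges. Unlike
`IsProperColoring`, this allows arbitrary types of vertices, indices and colors. -/
def ProperlyColors (e : ι → Set V) (c : V → α) : Prop :=
  ∀ i, (e i).Nontrivial → (c '' e i).Nontrivial

theorem properlyColors_sumElim {e : ι → Set V} {d : κ → Set V} {c : V → α} :
    ProperlyColors (Sum.elim e d) c ↔ ProperlyColors e c ∧ ProperlyColors d c :=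
  Sum.forall

theorem image_pair_nontrivial_iff {c : V → α} {u v : V} :
    (c '' {u, v}).Nontrivial ↔ c u ≠ c v := by
  rw [Set.image_pair]
  refine ⟨?_, Set.nontrivial_pair⟩
  rintro h heq
  simp [heq] at h

theorem exists_properlyColors_comp_equiv_iff {ι' V' : Type*} (σ : ι' ≃ ι) (τ : V' ≃ V)
    {e : ι → Set V} :
    (∃ c : V' → α, ProperlyColors (fun i => τ ⁻¹' e (σ i)) c) ↔
      ∃ c : V → α, ProperlyColors e c := by
  have precomp (c : V → α) : ProperlyColors (fun i => τ ⁻¹' e (σ i)) (c ∘ τ) ↔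
      ProperlyColors e c := by
    rw [ProperlyColors, ProperlyColors, σ.forall_congr_left]
    refine forall_congr' fun i => ?_
    simp only [Equiv.apply_symm_apply]
    rw [← Set.image_nontrivial τ.injective, Set.image_comp, τ.image_preimage]
  exact ⟨fun ⟨c, hc⟩ => ⟨c ∘ τ.symm, (precomp _).1 (by simpa [Function.comp_assoc] using hc)⟩,
    fun ⟨c, hc⟩ => ⟨c ∘ τ, (precomp c).2 hc⟩⟩

theorem nontrivial_imp_image_nontrivial_iff [Nonempty V] {e : Set V} {c : V → α} :
    (e.Nontrivial → (c '' e).Nontrivial) ↔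
      ∃ w : V × V, ∀ a ∈ e, a ≠ w.1 → w.1 ∈ e ∧ w.2 ∈ e ∧ c w.1 ≠ c w.2 := by
  constructor
  · intro h
    by_cases he : e.Nontrivial
    · obtain ⟨_, ⟨u, hu, rfl⟩, _, ⟨v, hv, rfl⟩, huv⟩ := h he
      exact ⟨(u, v), fun _ _ _ => ⟨hu, hv, huv⟩⟩
    · obtain rfl | ⟨u, rfl⟩ := (Set.not_nontrivial_iff.1 he).eq_empty_or_singleton
      · exact ⟨Classical.arbitrary _, fun a ha => ha.elim⟩
      · exact ⟨(u, u), fun a ha hau => absurd ha hau⟩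
  · rintro ⟨⟨u, v⟩, hw⟩ he
    obtain ⟨a, ha, hau⟩ := he.exists_ne u
    obtain ⟨hu, hv, huv⟩ := hw a ha hau
    exact ⟨c u, Set.mem_image_of_mem c hu, c v, Set.mem_image_of_mem c hv, huv⟩

end ProperlyColors

/-- The edge with index `i` of the hypergraph named `p`, empty if `i` is not an index. -/
def namedEdge (p : Baire) (i : ℕ) : Set ℕ :=
  {v | p (Nat.pair 1 i) ≠ 0 ∧ p (Nat.pair (i + 2) v) ≠ 0}

theorem oracleDecidable_mem_namedEdge :
    OracleDecidable fun p (x : ℕ × ℕ) => x.2 ∈ namedEdge p x.1 :=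
  (OracleDecidable.oracle_ne_zero.comp_primrec (Primrec₂.natPair.comp (.const 1) .fst)).and
    (OracleDecidable.oracle_ne_zero.comp_primrec
      (Primrec₂.natPair.comp (Primrec.nat_add.comp .fst (.const 2)) .snd))

namespace NamesHypergraph

variable {p : Baire} {H : CountableHypergraph}

theorem namedEdge_mem_edgeSet (hp : NamesHypergraph p H) {i : ℕ}
    (hi : (namedEdge p i).Nonempty) : namedEdge p i ∈ H.1.edgeSet := by
  obtain ⟨I, e, -, hI, he, hE⟩ := hp
  obtain ⟨-, hiI, -⟩ := hi
  rw [congrFun hI i, charFun_ne_zero_iff] at hiI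
  rw [hE]
  refine ⟨i, hiI, Set.ext fun v => ?_⟩
  simp only [namedEdge, Set.mem_ofPred_eq, congrFun hI i, congrFun (he i hiI) v,
    charFun_ne_zero_iff, hiI, true_and]

theorem exists_namedEdge_eq (hp : NamesHypergraph p H) {e : Set ℕ} (he : e ∈ H.1.edgeSet) :
    ∃ i, namedEdge p i = e := by
  obtain ⟨I, d, -, hI, hd, hE⟩ := hp
  rw [hE] at he
  obtain ⟨i, hiI, rfl⟩ := he
  refine ⟨i, Set.ext fun v => ?_⟩
  simp only [namedEdge, Set.mem_ofPred_eq, congrFun hI i, congrFun (hd i hiI) v,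
    charFun_ne_zero_iff, hiI, true_and]

theorem exists_isProperColoring_iff (hp : NamesHypergraph p H) {k : ℕ} (hk : 0 < k) :
    (∃ c : H.1.vertexSet → Fin k, IsProperColoring H c) ↔
      ∃ c : ℕ → Fin k, ProperlyColors (namedEdge p) c := by
  constructor
  · rintro ⟨c, hc⟩
    refine ⟨Function.extend Subtype.val c fun _ => ⟨0, hk⟩, fun i hi => ?_⟩
    obtain ⟨u, v, hu, hv, huv⟩ := hc _ (hp.namedEdge_mem_edgeSet hi.nonempty) hi
    refine ⟨_, Set.mem_image_of_mem _ hu, _, Set.mem_image_of_mem _ hv, ?_⟩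
    simpa only [Subtype.val_injective.extend_apply] using huv
  · rintro ⟨c, hc⟩
    refine ⟨fun v => c v, fun e he hnontrivial => ?_⟩
    have hsub : e ⊆ H.1.vertexSet := H.1.subset_vertexSet_of_mem_edgeSet' he
    obtain ⟨i, rfl⟩ := hp.exists_namedEdge_eq he
    obtain ⟨_, ⟨u, hu, rfl⟩, _, ⟨v, hv, rfl⟩, huv⟩ := hc i hnontrivial
    exact ⟨⟨u, hsub hu⟩, ⟨v, hsub hv⟩, hu, hv, huv⟩

end NamesHypergraph

/-! ### Colorability is reducible to well-foundedness -/

/-- The `n`-th constraint on a function `f` that is to code a proper `k`-coloring of the hypergraph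
named `p`. The entry `f i = ⟨c, ⟨u, v⟩⟩` means that the vertex `i` has color `c % k` and that `u`
and `v` are vertices of different colors in the edge `i`, unless this edge has no vertex but `u`.
The index `n = ⟨⟨i, a⟩, ⟨u, v⟩⟩` contains a guess of `u` and `v`, which makes the constraints
local. -/
def ColoringConstraint (k : ℕ) (p : Baire) (f : ℕ → ℕ) (n : ℕ) : Prop :=
  let i := n.unpair.1.unpair.1
  let a := n.unpair.1.unpair.2
  let u := n.unpair.2.unpair.1
  let v := n.unpair.2.unpair.2
  (f i).unpair.2 = n.unpair.2 → a ∈ namedEdge p i → a ≠ u →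
    u ∈ namedEdge p i ∧ v ∈ namedEdge p i ∧ (f u).unpair.1 % k ≠ (f v).unpair.1 % k

theorem isLocal_coloringConstraint (k : ℕ) (p : Baire) : IsLocal (ColoringConstraint k p) := by
  intro f g n hfg
  simp only [ColoringConstraint]
  rw [hfg _ ((Nat.unpair_left_le _).trans (Nat.unpair_left_le _)),
    hfg _ ((Nat.unpair_left_le _).trans (Nat.unpair_right_le _)),
    hfg _ ((Nat.unpair_right_le _).trans (Nat.unpair_right_le _))]
  exact id

theorem oracleDecidable_coloringConstraint (k : ℕ) :
    OracleDecidable fun p (x : List ℕ × ℕ) => ColoringConstraint k p (x.1.getD · 0) x.2 := by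
  have left {f : List ℕ × ℕ → ℕ} (hf : Primrec f) : Primrec fun x => (f x).unpair.1 :=
    Primrec.fst.comp (Primrec.unpair.comp hf)
  have right {f : List ℕ × ℕ → ℕ} (hf : Primrec f) : Primrec fun x => (f x).unpair.2 :=
    Primrec.snd.comp (Primrec.unpair.comp hf)
  have entry {f : List ℕ × ℕ → ℕ} (hf : Primrec f) :
      Primrec fun x : List ℕ × ℕ => x.1.getD (f x) 0 :=
    (Primrec.list_getD 0).comp .fst hf
  have color {f : List ℕ × ℕ → ℕ} (hf : Primrec f) :
      Primrec fun x : List ℕ × ℕ => (x.1.getD (f x) 0).unpair.1 % k :=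
    Primrec.nat_mod.comp (left (entry hf)) (.const k)
  have eq {f g : List ℕ × ℕ → ℕ} (hf : Primrec f) (hg : Primrec g) :
      OracleDecidable fun _ x => f x = g x :=
    .of_primrecPred (Primrec.eq.comp hf hg)
  have hi := left (left .snd)
  have ha := right (left .snd)
  have hu := left (right .snd)
  have hv := right (right .snd)
  have mem {f : List ℕ × ℕ → ℕ} (hf : Primrec f) :
      OracleDecidable fun p x => f x ∈ namedEdge p x.2.unpair.1.unpair.1 :=
    oracleDecidable_mem_namedEdge.comp_primrec (hi.pair hf)
  exact (eq (right (entry hi)) (right .snd)).imp <| (mem ha).imp <| (eq ha hu).not.imp <|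
    (mem hu).and <| (mem hv).and (eq (color hu) (color hv)).not

theorem forall_coloringConstraint_iff {k : ℕ} {p : Baire} {f : ℕ → ℕ} :
    (∀ n, ColoringConstraint k p f n) ↔
      ∀ i, ∀ a ∈ namedEdge p i, a ≠ (f i).unpair.2.unpair.1 →
        (f i).unpair.2.unpair.1 ∈ namedEdge p i ∧ (f i).unpair.2.unpair.2 ∈ namedEdge p i ∧
          (f (f i).unpair.2.unpair.1).unpair.1 % k ≠
            (f (f i).unpair.2.unpair.2).unpair.1 % k := by
  constructor
  · intro h i a
    simpa [ColoringConstraint] using h (Nat.pair (Nat.pair i a) (f i).unpair.2)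
  · intro h n hn
    rw [← hn]
    exact h _ _

theorem exists_properlyColors_namedEdge_iff {k : ℕ} (hk : 0 < k) (p : Baire) :
    (∃ c : ℕ → Fin k, ProperlyColors (namedEdge p) c) ↔ ∃ f, ∀ n, ColoringConstraint k p f n := by
  simp only [ProperlyColors, nontrivial_imp_image_nontrivial_iff, forall_coloringConstraint_iff]
  constructor
  · rintro ⟨c, hc⟩
    choose w hw using hc
    refine ⟨fun i => Nat.pair (c i) (Nat.pair (w i).1 (w i).2), fun i => ?_⟩
    simpa [Nat.mod_eq_of_lt (Fin.is_lt _), Fin.val_inj] using hw i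
  · rintro ⟨f, hf⟩
    refine ⟨fun v => ⟨(f v).unpair.1 % k, Nat.mod_lt _ hk⟩, fun i => ⟨(f i).unpair.2.unpair, ?_⟩⟩
    simpa only [ne_eq, Fin.mk.injEq] using hf i

theorem hpc_strongWeihrauchReducible_wf {k : ℕ} (hk : 0 < k) :
    StrongWeihrauchReducible (HPC k) WF :=
  decisionProblem_strongWeihrauchReducible_wf (isLocal_coloringConstraint k)
    (oracleDecidable_coloringConstraint k) fun p _ hp =>
      (NamesHypergraph.exists_isProperColoring_iff hp hk).trans
        (exists_properlyColors_namedEdge_iff hk p)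

/-! ### Reducing to colorability -/

/-- The hypergraph with vertex set `ℕ` and the edges `e i` for all `i : ℕ`. -/
def hypergraphOfEdges (e : ℕ → Set ℕ) : CountableHypergraph :=
  ⟨⟨Set.univ, Set.range e, fun _ _ => Set.subset_univ _⟩, Set.countable_range e⟩

/-- The set whose characteristic function is a name of `hypergraphOfEdges e`. -/
def hypergraphCode (e : ℕ → Set ℕ) : Set ℕ :=
  {n | n.unpair.1 = 0 ∨ n.unpair.1 = 1 ∨ n.unpair.2 ∈ e (n.unpair.1 - 2)}

theorem charFun_pair_hypergraphCode (e : ℕ → Set ℕ) (i v : ℕ) :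
    charFun (hypergraphCode e) (Nat.pair (i + 2) v) = charFun (e i) v := by
  by_cases hv : v ∈ e i <;> simp [charFun, hypergraphCode, hv]

theorem namesHypergraph_hypergraphCode (e : ℕ → Set ℕ) :
    NamesHypergraph (charFun (hypergraphCode e)) (hypergraphOfEdges e) := by
  refine ⟨Set.univ, e, ?_, ?_, fun i _ => funext (charFun_pair_hypergraphCode e i),
    Set.image_univ.symm⟩ <;>
  · funext
    simp [charFun, hypergraphCode, hypergraphOfEdges]

theorem namedEdge_hypergraphCode (e : ℕ → Set ℕ) :
    namedEdge (charFun (hypergraphCode e)) = e := by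
  ext i v
  simp only [namedEdge, Set.mem_ofPred_eq, charFun_pair_hypergraphCode, charFun_ne_zero_iff]
  simp [hypergraphCode]

theorem decisionProblem_strongWeihrauchReducible_hpc {X ι V : Type*} [RepresentedSpace X]
    [Denumerable ι] [Denumerable V] {k : ℕ} (hk : 0 < k) {A : X → Prop}
    {E : Baire → ι → Set V} (hE : OracleDecidable fun p (x : ι × V) => x.2 ∈ E p x.1)
    (h : ∀ p x, RepresentedSpace.Names p x → (A x ↔ ¬ ∃ c : V → Fin k, ProperlyColors (E p) c)) :
    StrongWeihrauchReducible (decisionProblem A) (HPC k) := by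
  let σ : ℕ ≃ ι := (Denumerable.eqv ι).symm
  let τ : ℕ ≃ V := (Denumerable.eqv V).symm
  let e (p : Baire) (i : ℕ) : Set ℕ := τ ⁻¹' E p (σ i)
  have hcomp : ComputableOnBaire fun p => Part.some (charFun (hypergraphCode (e p))) := by
    have row : Primrec fun n : ℕ => n.unpair.1 := Primrec.fst.comp .unpair
    have edge := (Primrec.ofNat ι).comp (Primrec.nat_sub.comp row (.const 2))
    have vertex := (Primrec.ofNat V).comp (Primrec.snd.comp .unpair)
    exact OracleDecidable.computableOnBaire_charFun <|
      (OracleDecidable.of_primrecPred (Primrec.eq.comp row (.const 0))).or <|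
      (OracleDecidable.of_primrecPred (Primrec.eq.comp row (.const 1))).or <|
        hE.comp_primrec (edge.pair vertex)
  refine strongWeihrauchReducible_of_iff_not hcomp fun p x hp =>
    ⟨_, namesHypergraph_hypergraphCode (e p), ?_⟩
  rw [h p x hp, (namesHypergraph_hypergraphCode (e p)).exists_isProperColoring_iff hk,
    namedEdge_hypergraphCode, exists_properlyColors_comp_equiv_iff]

/-! ### Well-foundedness is reducible to colorability -/

/-- The vertices of the hypergraph of a tree: a palette of colors and, for each finite sequence,
a positive and a negative literal. The palette is infinite so that the type is denumerable. -/
abbrev TreeVertex : Type := ℕ ⊕ List ℕ ⊕ List ℕ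

namespace TreeVertex

/-- The vertex of the palette with number `a`. In a hypergraph to be colored with `m + 2` colors,
those with `a < m` use up `m` colors, and the color of the one with `a = m` represents falsity. -/
abbrev palette (a : ℕ) : TreeVertex := .inl a

/-- The literal that says that the node `s` is true. -/
abbrev pos (s : List ℕ) : TreeVertex := .inr (.inl s)

/-- The literal that says that the node `s` is false. -/
abbrev neg (s : List ℕ) : TreeVertex := .inr (.inr s)

theorem primrec_palette : Primrec palette := Primrec.sumInl

theorem primrec_pos : Primrec pos := Primrec.sumInr.comp .sumInl

theorem primrec_neg : Primrec neg := Primrec.sumInr.comp .sumInr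

/-- The last entry of the sequence that a literal is about, used to decode a node `s ++ [a]` of
the tree without a search. For vertices of the palette this is a junk value. -/
def lastEntry : TreeVertex → ℕ :=
  Sum.elim id (Sum.elim (·.reverse.headI) (·.reverse.headI))

theorem primrec_lastEntry : Primrec lastEntry := by
  have last : Primrec fun s : List ℕ => s.reverse.headI :=
    Primrec.list_headI.comp Primrec.list_reverse
  have literal : Primrec (Sum.elim (·.reverse.headI) (·.reverse.headI) : List ℕ ⊕ List ℕ → ℕ) :=
    (Primrec.sumCasesOn .id (last.comp .snd).to₂ (last.comp .snd).to₂).of_eq (by simp)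
  exact (Primrec.sumCasesOn .id .right (literal.comp .snd).to₂).of_eq (by simp [lastEntry])

end TreeVertex

section TreeEdge

open TreeVertex

/-- The edges `{palette a, v}` with `a < m`, which reserve `m` colors for the palette, and the edge
`{palette m, pos []}`, which makes the root true. The other indices `(a, v)` give empty edges. -/
def paletteEdge (m : ℕ) (x : ℕ × TreeVertex) : Set TreeVertex :=
  {w | (x.1 < m ∨ x.1 = m ∧ x.2 = pos []) ∧ w ∈ ({palette x.1, x.2} : Set TreeVertex)}

/-- The edge that gives the two literals of a node opposite truth values. -/
def literalEdge (s : List ℕ) : Set TreeVertex :=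
  {pos s, neg s}

/-- The edge that makes a child of the node `s` in `T` true if `s` is true. -/
def clauseEdge (m : ℕ) (T : Set (List ℕ)) (s : List ℕ) : Set TreeVertex :=
  {palette m, neg s} ∪ {w | ∃ a, s ++ [a] ∈ T ∧ pos (s ++ [a]) = w}

/-- The edges of a hypergraph that is colorable with `m + 2` colors if and only if the tree `T` has
an infinite path. -/
def treeEdge (m : ℕ) (T : Set (List ℕ)) : (ℕ × TreeVertex) ⊕ List ℕ ⊕ List ℕ → Set TreeVertex :=
  Sum.elim (paletteEdge m) (Sum.elim literalEdge (clauseEdge m T))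

section Characterization

variable {α : Type*} {m : ℕ} {c : TreeVertex → α}

theorem properlyColors_paletteEdge_iff :
    ProperlyColors (paletteEdge m) c ↔
      (∀ a < m, ∀ v ≠ palette a, c (palette a) ≠ c v) ∧ c (palette m) ≠ c (pos []) := by
  have edge_eq {a : ℕ} {v : TreeVertex} (h : a < m ∨ a = m ∧ v = pos []) :
      paletteEdge m (a, v) = {palette a, v} := by
    simp only [paletteEdge, h, true_and, Set.ofPred_mem_eq]
  constructor
  · intro h
    have separated {a : ℕ} {v : TreeVertex} (hav : a < m ∨ a = m ∧ v = pos [])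
        (hv : v ≠ palette a) : c (palette a) ≠ c v := by
      have := h (a, v)
      rw [edge_eq hav] at this
      exact image_pair_nontrivial_iff.1 (this (Set.nontrivial_pair hv.symm))
    exact ⟨fun a ha v => separated (.inl ha), separated (.inr ⟨rfl, rfl⟩) (by simp)⟩
  · rintro ⟨hpalette, hroot⟩ ⟨a, v⟩ hav
    have hindex : a < m ∨ a = m ∧ v = pos [] := hav.nonempty.some_mem.1
    rw [edge_eq hindex] at hav ⊢
    rw [image_pair_nontrivial_iff]
    obtain ha | ⟨rfl, rfl⟩ := hindex
    · refine hpalette a ha v ?_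
      rintro rfl
      simp at hav
    · exact hroot

theorem properlyColors_literalEdge_iff :
    ProperlyColors literalEdge c ↔ ∀ s, c (pos s) ≠ c (neg s) :=
  forall_congr' fun s => by
    rw [literalEdge, image_pair_nontrivial_iff]
    exact forall_prop_of_true (Set.nontrivial_pair (by simp))

theorem properlyColors_clauseEdge_iff {T : Set (List ℕ)} :
    ProperlyColors (clauseEdge m T) c ↔ ∀ s, c (neg s) = c (palette m) →
      ∃ a, s ++ [a] ∈ T ∧ c (pos (s ++ [a])) ≠ c (palette m) := by
  refine forall_congr' fun s => ?_
  have hnontrivial : (clauseEdge m T s).Nontrivial :=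
    (Set.nontrivial_pair (by simp)).mono Set.subset_union_left
  have hfalse : c (palette m) ∈ c '' clauseEdge m T s := Set.mem_image_of_mem c (.inl (.inl rfl))
  have hclause : (∃ w ∈ clauseEdge m T s, c w ≠ c (palette m)) ↔
      c (neg s) ≠ c (palette m) ∨ ∃ a, s ++ [a] ∈ T ∧ c (pos (s ++ [a])) ≠ c (palette m) := by
    constructor
    · rintro ⟨_, (rfl | rfl) | ⟨a, ha, rfl⟩, hw⟩
      exacts [absurd rfl hw, .inl hw, .inr ⟨a, ha, hw⟩]
    · rintro (hneg | ⟨a, ha, hw⟩)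
      exacts [⟨_, .inl (.inr rfl), hneg⟩, ⟨_, .inr ⟨a, ha, rfl⟩, hw⟩]
  rw [forall_prop_of_true hnontrivial, Set.nontrivial_iff_exists_ne hfalse, Set.exists_mem_image,
    hclause, imp_iff_not_or]

theorem properlyColors_treeEdge_iff {T : Set (List ℕ)} :
    ProperlyColors (treeEdge m T) c ↔
      ((∀ a < m, ∀ v ≠ palette a, c (palette a) ≠ c v) ∧ c (palette m) ≠ c (pos [])) ∧
      (∀ s, c (pos s) ≠ c (neg s)) ∧
      ∀ s, c (neg s) = c (palette m) →
        ∃ a, s ++ [a] ∈ T ∧ c (pos (s ++ [a])) ≠ c (palette m) := by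
  rw [treeEdge, properlyColors_sumElim, properlyColors_sumElim, properlyColors_paletteEdge_iff,
    properlyColors_literalEdge_iff, properlyColors_clauseEdge_iff]

end Characterization

section Decidability

variable (m : ℕ)

theorem primrecPred_mem_paletteEdge :
    PrimrecPred fun x : (ℕ × TreeVertex) × TreeVertex => x.2 ∈ paletteEdge m x.1 := by
  have a : Primrec fun x : (ℕ × TreeVertex) × TreeVertex => x.1.1 := Primrec.fst.comp .fst
  have v : Primrec fun x : (ℕ × TreeVertex) × TreeVertex => x.1.2 := Primrec.snd.comp .fst
  have index := (Primrec.nat_lt.comp a (.const m)).or <|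
    (Primrec.eq.comp a (.const m)).and (Primrec.eq.comp v (.const (pos [])))
  exact index.and <| (Primrec.eq.comp .snd (primrec_palette.comp a)).or (Primrec.eq.comp .snd v)

theorem primrecPred_mem_literalEdge :
    PrimrecPred fun x : List ℕ × TreeVertex => x.2 ∈ literalEdge x.1 :=
  (Primrec.eq.comp .snd (primrec_pos.comp .fst)).or (Primrec.eq.comp .snd (primrec_neg.comp .fst))

theorem oracleDecidable_mem_clauseEdge {T : Baire → Set (List ℕ)}
    (hT : OracleDecidable fun p s => s ∈ T p) :
    OracleDecidable fun p (x : List ℕ × TreeVertex) => x.2 ∈ clauseEdge m (T p) x.1 := by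
  have child : Primrec fun x : List ℕ × ℕ => x.1 ++ [x.2] := Primrec.list_concat
  have base : PrimrecPred fun x : List ℕ × TreeVertex => x.2 = palette m ∨ x.2 = neg x.1 :=
    (Primrec.eq.comp .snd (.const _)).or (Primrec.eq.comp .snd (primrec_neg.comp .fst))
  exact (OracleDecidable.of_primrecPred base).or <|
    OracleDecidable.exists_and_eq_of_leftInverse (hT.comp_primrec child)
      (primrec_pos.comp child) primrec_lastEntry fun x => by simp [lastEntry]

theorem oracleDecidable_mem_treeEdge {T : Baire → Set (List ℕ)}
    (hT : OracleDecidable fun p s => s ∈ T p) :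
    OracleDecidable fun p (x : ((ℕ × TreeVertex) ⊕ List ℕ ⊕ List ℕ) × TreeVertex) =>
      x.2 ∈ treeEdge m (T p) x.1 :=
  (OracleDecidable.of_primrecPred (primrecPred_mem_paletteEdge m)).sumElim <|
    (OracleDecidable.of_primrecPred primrecPred_mem_literalEdge).sumElim
      (oracleDecidable_mem_clauseEdge m hT)

end Decidability

theorem exists_path_of_forall_exists_concat {α : Type*} {P : List α → Prop} (h₀ : P [])
    (h : ∀ s, P s → ∃ a, P (s ++ [a])) : ∃ f : ℕ → α, ∀ n, P ((List.range n).map f) := by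
  choose next hnext using h
  let node (n : ℕ) : {s : List α // P s} :=
    n.rec ⟨[], h₀⟩ fun _ s => ⟨s.1 ++ [next s.1 s.2], hnext s.1 s.2⟩
  let f (n : ℕ) : α := next (node n).1 (node n).2
  have map_range_eq (n : ℕ) : (List.range n).map f = (node n).1 := by
    induction n with
    | zero => rfl
    | succ n ih => rw [List.range_succ, List.map_append, ih]; rfl
  exact ⟨f, fun n => map_range_eq n ▸ (node n).2⟩

theorem eq_or_eq_of_notMem {α : Type*} [Fintype α] {C : Finset α}
    (hC : Fintype.card α ≤ C.card + 2) {x y z : α} (hx : x ∉ C) (hy : y ∉ C) (hz : z ∉ C)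
    (hxy : x ≠ y) : z = x ∨ z = y := by
  classical
  by_contra! hne
  have : 2 < Cᶜ.card := Finset.two_lt_card.2
    ⟨x, by simpa, y, by simpa, z, by simpa, hxy, hne.1.symm, hne.2.symm⟩
  rw [Finset.card_compl] at this
  omega

theorem exists_path_of_properlyColors_treeEdge {m : ℕ} {T : Descriptive.tree ℕ}
    {c : TreeVertex → Fin (m + 2)} (hc : ProperlyColors (treeEdge m T) c) :
    ∃ f : ℕ → ℕ, ∀ n, (List.range n).map f ∈ T := by
  obtain ⟨⟨hpalette, hroot⟩, hliteral, hclause⟩ := properlyColors_treeEdge_iff.1 hc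
  let C : Finset (Fin (m + 2)) := (Finset.range m).image fun a => c (palette a)
  have hC : C.card = m := by
    rw [Finset.card_image_of_injOn, Finset.card_range]
    intro a ha b _ hab
    by_contra hne
    exact hpalette a (by simpa using ha) (palette b) (by simpa [eq_comm] using hne) hab
  have notMem {v : TreeVertex} (hv : ∀ a < m, v ≠ palette a) : c v ∉ C := by
    simp only [C, Finset.mem_image, Finset.mem_range, not_exists, not_and]
    exact fun a ha => hpalette a ha v (hv a ha)
  have neg_false {s : List ℕ} (hs : c (pos s) ≠ c (palette m)) : c (neg s) = c (palette m) :=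
    ((eq_or_eq_of_notMem (by simp [hC]) (notMem (by simp)) (notMem (by simp))
      (notMem fun a ha => by simpa using ha.ne') (hliteral s)).resolve_left hs.symm).symm
  obtain ⟨f, hf⟩ := exists_path_of_forall_exists_concat
    (P := fun s => c (pos s) ≠ c (palette m) ∧ (s ≠ [] → s ∈ T)) ⟨hroot.symm, by simp⟩
    fun s hs => (hclause s (neg_false hs.1)).imp fun a ha => ⟨ha.2, fun _ => ha.1⟩
  refine ⟨f, fun n => Descriptive.Tree.mem_of_append (y := [f n]) ?_⟩
  simpa [List.range_succ] using (hf (n + 1)).2 (by simp)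

open Classical in
/-- The coloring of the vertices of `treeEdge m T` in which the true nodes are those in `S`, with
the colors `m` for falsity and `m + 1` for truth. -/
noncomputable def treeColoring (m : ℕ) (S : Set (List ℕ)) : TreeVertex → Fin (m + 2) :=
  Sum.elim (fun a => ⟨min a m, by omega⟩)
    (Sum.elim (fun s => ⟨if s ∈ S then m + 1 else m, by split <;> omega⟩)
      fun s => ⟨if s ∈ S then m else m + 1, by split <;> omega⟩)

theorem properlyColors_treeColoring {m : ℕ} {T S : Set (List ℕ)} (hroot : [] ∈ S)
    (hchild : ∀ s ∈ S, ∃ a, s ++ [a] ∈ T ∧ s ++ [a] ∈ S) :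
    ProperlyColors (treeEdge m T) (treeColoring m S) := by
  refine properlyColors_treeEdge_iff.2 ⟨⟨?_, ?_⟩, fun s => ?_, fun s hs => ?_⟩
  · rintro a ha (b | s | s) hv <;>
      simp only [treeColoring, Sum.elim_inl, Sum.elim_inr, ne_eq, Fin.mk.injEq] <;> grind
  · simp [treeColoring, hroot]
  · by_cases hs : s ∈ S <;> simp [treeColoring, hs]
  · have hsS : s ∈ S := by
      by_contra hsS
      simp [treeColoring, hsS] at hs
    obtain ⟨a, haT, haS⟩ := hchild s hsS
    exact ⟨a, haT, by simp [treeColoring, haS]⟩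

theorem exists_properlyColors_treeEdge_iff (m : ℕ) (T : Descriptive.tree ℕ) :
    (∃ c : TreeVertex → Fin (m + 2), ProperlyColors (treeEdge m T) c) ↔
      ∃ f : ℕ → ℕ, ∀ n, (List.range n).map f ∈ T := by
  refine ⟨fun ⟨c, hc⟩ => exists_path_of_properlyColors_treeEdge hc, fun ⟨f, hf⟩ => ?_⟩
  refine ⟨treeColoring m (Set.range fun n => (List.range n).map f),
    properlyColors_treeColoring ⟨0, rfl⟩ ?_⟩
  rintro _ ⟨n, rfl⟩
  have hsucc : (List.range (n + 1)).map f = (List.range n).map f ++ [f n] := by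
    simp [List.range_succ]
  exact ⟨f n, hsucc ▸ hf (n + 1), n + 1, hsucc⟩

theorem wf_strongWeihrauchReducible_hpc {k : ℕ} (hk : 2 ≤ k) :
    StrongWeihrauchReducible WF (HPC k) := by
  obtain ⟨m, rfl⟩ := Nat.exists_eq_add_of_le' hk
  refine decisionProblem_strongWeihrauchReducible_hpc (by omega)
    (oracleDecidable_mem_treeEdge m (T := fun p => {s | p (Encodable.encode s) ≠ 0})
      (OracleDecidable.oracle_ne_zero.comp_primrec .encode)) fun p T hp => ?_
  have hT : {s | p (Encodable.encode s) ≠ 0} = (T : Set (List ℕ)) := by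
    obtain rfl : p = charFun (Encodable.encode '' (T : Set (List ℕ))) := hp
    ext s
    simp only [Set.mem_ofPred_eq, charFun_ne_zero_iff, Encodable.encode_injective.mem_set_image]
  rw [hT, exists_properlyColors_treeEdge_iff, IsWellFoundedTree]

end TreeEdge

theorem theorem8 (k : ℕ) (hk : 2 ≤ k) : StrongWeihrauchEquiv (HPC k) WF :=
  ⟨hpc_strongWeihrauchReducible_wf (by omega), wf_strongWeihrauchReducible_hpc hk⟩
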